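/- Let $\Omega$ be a locally compact Hausdorff space and let $E$, $F$ be Hilbert $C_0(\Omega)$-modules (complete, with inner products linear in the second variable). For $\omega\in\Omega$ put $K^E_\omega=\{e\in E:\langle e,e\rangle(\omega)=0\}$ and let $\Xi^E_\omega=E/K^E_\omega$ be the fibre at $\omega$, with inner product induced by $(e,g)\mapsto\langle e,g\rangle(\omega)$; write $e(\omega)$ for the class of $e$ in $\Xi^E_\omega$, and similarly for $F$. Let $\Omega_E=\{\omega\in\Omega:\Xi^E_\omega\neq 0\}$. For an open set $U\subseteq\Omega$ let $E_U=\{e\in E: e(\omega)=0\ \text{for all}\ \omega\in\Omega\setminus U\}$, a module over $C_0(U)$, which is identified (through extension by zero) with the functions in $C_0(\Omega)$ vanishing outside $U$; define $F_U$ in the same way. Let $\theta:E\to F$ be a $\mathbb{C}$-linear map, not assumed to be bounded, which is local ($ea=0$ implies $\theta(e)a=0$, for $e\in E$ and $a\in C_0(\Omega)$) and orthogonality preserving ($\langle x,y\rangle=0$ implies $\langle\theta(x),\theta(y)\rangle=0$, for $x,y\in E$). Let $\Omega_\theta=\{\omega\in\Omega:\theta(e)(\omega)\neq0\text{ for some }e\in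 E\}$, which is an open subset of $\Omega$. Then: (a) $\theta$ is a bounded $C_0(\Omega)$-module homomorphism. (b) There is a bounded function $\varphi:\Omega\to[0,\infty)$, continuous on $\Omega_E$, such that $\langle\theta(e),\theta(g)\rangle(\omega)=\varphi(\omega)\,\langle e,g\rangle(\omega)$ for all $e,g\in E$ and $\omega\in\Omega$. (c) There exist a bounded continuous function $\psi_0:\Omega_\theta\to(0,\infty)$ and a bounded $C_0(\Omega_\theta)$-module homomorphism $J:E_{\Omega_\theta}\to F_{\Omega_\theta}$ such that for every $\omega\in\Omega_\theta$ there is a linear isometry $J_\omega:\Xi^E_\omega\to\Xi^F_\omega$ with $J_\omega(g(\omega))=J(g)(\omega)$ for all $g\in E_{\Omega_\theta}$ (the fibre map of $J$), and $$\theta(e)(\omega)=\psi_0(\omega)\,J_\omega(e(\omega))\qquad\text{for all }e\in E,\ \omega\in\Omega_\theta .$$ -/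

import Mathlib

open scoped ZeroAtInfty ComplexOrder BoundedContinuousFunction
open TopologicalSpace

noncomputable section

namespace HilbertC0

section General

variable (A : Type*) {E F : Type*} [NormedAddCommGroup E] [NormedSpace ℂ E]
  [NormedAddCommGroup F] [NormedSpace ℂ F] [SMul A E] [SMul A F]

/-- `θ` is local: `e a = 0` implies `θ(e) a = 0`. -/
def IsLocalMap (θ : E →ₗ[ℂ] F) : Prop :=
  ∀ (e : E) (a : A), a • e = 0 → a • θ e = 0

/-- `θ` preserves orthogonality with respect to the `A`-valued inner products. -/
def IsOrthogonalityPreserving [Zero A] [Inner A E] [Inner A F] (θ : E →ₗ[ℂ] F) : Prop :=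
  ∀ x y : E, inner A x y = 0 → inner A (θ x) (θ y) = 0

/-- `T` is a bounded `A`-module homomorphism. -/
def IsBoundedModuleMap (T : E →ₗ[ℂ] F) : Prop :=
  (∃ C : ℝ, ∀ e : E, ‖T e‖ ≤ C * ‖e‖) ∧ ∀ (a : A) (e : E), T (a • e) = a • T e

end General

variable {Ω : Type*} [TopologicalSpace Ω]

/-- The pointwise order on `C₀(Ω)`, which is its order as a C⋆-algebra. -/
instance instPartialOrderC0 : PartialOrder C₀(Ω, ℂ) :=
  PartialOrder.lift (fun f : C₀(Ω, ℂ) => (f : Ω → ℂ)) DFunLike.coe_injective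

section Fibres

variable (E : Type*) [NormedAddCommGroup E] [NormedSpace ℂ E] [SMul C₀(Ω, ℂ) E]
  [CStarModule C₀(Ω, ℂ) E]

/-- The semi-inner product `(e, g) ↦ ⟨e, g⟩(ω)` on `E`. -/
@[reducible]
def preCore (ω : Ω) : PreInnerProductSpace.Core ℂ E where
  inner e g := inner C₀(Ω, ℂ) e g ω
  conj_inner_symm e g := by
    exact DFunLike.congr_fun (CStarModule.star_inner (A := C₀(Ω, ℂ)) g e) ω
  re_inner_nonneg e := by
    have h : (0 : C₀(Ω, ℂ)) ≤ inner C₀(Ω, ℂ) e e := CStarModule.inner_self_nonneg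
    have h' : (0 : ℂ) ≤ inner C₀(Ω, ℂ) e e ω := h ω
    exact (Complex.le_def.1 h').1
  add_left e g h := by
    rw [CStarModule.inner_add_left]; rfl
  smul_left e g r := by
    rw [CStarModule.inner_smul_left_complex]; rfl

variable {E}

theorem inner_apply_eq_zero_of_right {ω : Ω} (e : E) {k : E}
    (hk : inner C₀(Ω, ℂ) k k ω = 0) : inner C₀(Ω, ℂ) e k ω = 0 := by
  have h := @InnerProductSpace.Core.inner_mul_inner_self_le ℂ E _ _ _ (preCore E ω) e k
  have hs := @InnerProductSpace.Core.norm_inner_symm ℂ E _ _ _ (preCore E ω) e k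
  change ‖inner C₀(Ω, ℂ) e k ω‖ * ‖inner C₀(Ω, ℂ) k e ω‖ ≤
    RCLike.re (inner C₀(Ω, ℂ) e e ω) * RCLike.re (inner C₀(Ω, ℂ) k k ω) at h
  change ‖inner C₀(Ω, ℂ) e k ω‖ = ‖inner C₀(Ω, ℂ) k e ω‖ at hs
  rw [← hs, hk, map_zero, mul_zero] at h
  exact norm_eq_zero.1 (mul_self_eq_zero.1 (le_antisymm h (mul_self_nonneg _)))

theorem inner_apply_eq_zero_of_left {ω : Ω} {k : E} (e : E)
    (hk : inner C₀(Ω, ℂ) k k ω = 0) : inner C₀(Ω, ℂ) k e ω = 0 := by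
  have hs := @InnerProductSpace.Core.norm_inner_symm ℂ E _ _ _ (preCore E ω) e k
  change ‖inner C₀(Ω, ℂ) e k ω‖ = ‖inner C₀(Ω, ℂ) k e ω‖ at hs
  rw [inner_apply_eq_zero_of_right e hk, norm_zero] at hs
  exact norm_eq_zero.1 hs.symm

variable (E)

/-- `K_S`: the elements of `E` that vanish at every point of `S`, where `e` vanishes at `ω` if
`⟨e, e⟩(ω) = 0`. -/
def vanishingOn (S : Set Ω) : Submodule ℂ E where
  carrier := {e | ∀ ω ∈ S, inner C₀(Ω, ℂ) e e ω = 0}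
  zero_mem' ω _ := by rw [CStarModule.inner_zero_left]; rfl
  add_mem' {e g} he hg ω hω := by
    rw [CStarModule.inner_add_left, CStarModule.inner_add_right, CStarModule.inner_add_right]
    simp [he ω hω, hg ω hω, inner_apply_eq_zero_of_right e (hg ω hω),
      inner_apply_eq_zero_of_left e (hg ω hω)]
  smul_mem' c e he ω hω := by
    rw [CStarModule.inner_smul_left_complex, CStarModule.inner_smul_right_complex]
    simp [he ω hω]

/-- The fibre `Ξ_ω = E / K_ω` of the Hilbert bundle of `E`. -/
def Fibre (ω : Ω) : Type _ := E ⧸ vanishingOn E ({ω} : Set Ω)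

instance (ω : Ω) : AddCommGroup (Fibre E ω) :=
  inferInstanceAs (AddCommGroup (E ⧸ vanishingOn E ({ω} : Set Ω)))

instance (ω : Ω) : Module ℂ (Fibre E ω) :=
  inferInstanceAs (Module ℂ (E ⧸ vanishingOn E ({ω} : Set Ω)))

variable {E}

/-- The value `e(ω)` of the section `e` at `ω`, that is, the class of `e` in `E / K_ω`. -/
def value (ω : Ω) : E →ₗ[ℂ] Fibre E ω := (vanishingOn E ({ω} : Set Ω)).mkQ

theorem value_surjective (ω : Ω) : Function.Surjective (value (E := E) ω) :=
  Submodule.mkQ_surjective _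

theorem value_eq_zero_iff {ω : Ω} {e : E} : value ω e = 0 ↔ inner C₀(Ω, ℂ) e e ω = 0 := by
  have h : value ω e = 0 ↔ e ∈ vanishingOn E ({ω} : Set Ω) := Submodule.Quotient.mk_eq_zero _
  rw [h]
  exact ⟨fun h => h ω rfl, fun h ω' hω' => by rw [Set.mem_singleton_iff.1 hω']; exact h⟩

theorem value_eq_value_iff {ω : Ω} {e g : E} :
    value ω e = value ω g ↔ inner C₀(Ω, ℂ) (e - g) (e - g) ω = 0 := by
  rw [← value_eq_zero_iff, map_sub, sub_eq_zero]

theorem inner_apply_congr {ω : Ω} {e e' g g' : E} (he : value ω e = value ω e')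
    (hg : value ω g = value ω g') :
    inner C₀(Ω, ℂ) e g ω = inner C₀(Ω, ℂ) e' g' ω := by
  have h1 := inner_apply_eq_zero_of_left g (value_eq_value_iff.1 he)
  have h2 := inner_apply_eq_zero_of_right e' (value_eq_value_iff.1 hg)
  rw [CStarModule.inner_sub_left, ZeroAtInftyContinuousMap.sub_apply, sub_eq_zero] at h1
  rw [CStarModule.inner_sub_right, ZeroAtInftyContinuousMap.sub_apply, sub_eq_zero] at h2
  rw [h1, h2]

variable (E)

/-- The inner product of the fibre, `⟨e(ω), g(ω)⟩ = ⟨e, g⟩(ω)`; see `fibreInner_value`. -/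
def fibreInner (ω : Ω) (ξ η : Fibre E ω) : ℂ :=
  inner C₀(Ω, ℂ) (Function.surjInv (value_surjective ω) ξ)
    (Function.surjInv (value_surjective ω) η) ω

variable {E}

theorem fibreInner_value (ω : Ω) (e g : E) :
    fibreInner E ω (value ω e) (value ω g) = inner C₀(Ω, ℂ) e g ω :=
  inner_apply_congr (Function.surjInv_eq _ _) (Function.surjInv_eq _ _)

variable (E)

@[reducible]
def fibreCore (ω : Ω) : InnerProductSpace.Core ℂ (Fibre E ω) where
  inner := fibreInner E ω
  conj_inner_symm ξ η := by
    obtain ⟨e, rfl⟩ := value_surjective ω ξ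
    obtain ⟨g, rfl⟩ := value_surjective ω η
    change (starRingEnd ℂ) (fibreInner E ω _ _) = fibreInner E ω _ _
    rw [fibreInner_value, fibreInner_value]
    exact (preCore E ω).conj_inner_symm e g
  re_inner_nonneg ξ := by
    obtain ⟨e, rfl⟩ := value_surjective ω ξ
    rw [fibreInner_value]
    exact (preCore E ω).re_inner_nonneg e
  add_left ξ η ζ := by
    obtain ⟨e, rfl⟩ := value_surjective ω ξ
    obtain ⟨g, rfl⟩ := value_surjective ω η
    obtain ⟨h, rfl⟩ := value_surjective ω ζ
    change fibreInner E ω _ _ = fibreInner E ω _ _ + fibreInner E ω _ _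
    rw [← map_add, fibreInner_value, fibreInner_value, fibreInner_value]
    exact (preCore E ω).add_left e g h
  smul_left ξ η r := by
    obtain ⟨e, rfl⟩ := value_surjective ω ξ
    obtain ⟨g, rfl⟩ := value_surjective ω η
    change fibreInner E ω _ _ = (starRingEnd ℂ) r * fibreInner E ω _ _
    rw [← map_smul, fibreInner_value, fibreInner_value]
    exact (preCore E ω).smul_left e g r
  definite ξ h := by
    obtain ⟨e, rfl⟩ := value_surjective ω ξ
    change fibreInner E ω _ _ = 0 at h
    rw [fibreInner_value] at h
    exact value_eq_zero_iff.2 h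

instance (ω : Ω) : NormedAddCommGroup (Fibre E ω) := (fibreCore E ω).toNormedAddCommGroup

instance (ω : Ω) : InnerProductSpace ℂ (Fibre E ω) :=
  InnerProductSpace.ofCore (fibreCore E ω).toCore

variable (Ω)

/-- `Ω_E`: the points whose fibre is non-zero. -/
def nonzeroFibres : Set Ω := {ω | Nontrivial (Fibre E ω)}

end Fibres

section Restriction

variable [T2Space Ω]

/-- Extension by zero `C₀(U) → C₀(Ω)` for an open set `U`, through which `C₀(U)` is identified
with the functions in `C₀(Ω)` that vanish outside `U`. -/
def extendZero (U : Opens Ω) (f : C₀(U, ℂ)) : C₀(Ω, ℂ) :=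
  have small : ∀ ε > 0, ∃ K : Set Ω, IsCompact K ∧ K ⊆ U ∧
      ∀ ω ∉ K, ‖Function.extend (Subtype.val : U → Ω) f 0 ω‖ < ε := by
    intro ε hε
    have h : ∀ᶠ x in Filter.cocompact U, ‖f x‖ < ε := by
      have := (zero_at_infty f).norm
      rw [norm_zero] at this
      exact this.eventually (gt_mem_nhds hε)
    obtain ⟨K, hK, hKs⟩ := Filter.mem_cocompact.1 h
    refine ⟨Subtype.val '' K, hK.image continuous_subtype_val, by rintro _ ⟨x, _, rfl⟩; exact x.2,
      fun ω hω => ?_⟩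
    by_cases hU : ω ∈ U
    · have := Subtype.val_injective.extend_apply f (0 : Ω → ℂ) (⟨ω, hU⟩ : U)
      rw [show ω = ((⟨ω, hU⟩ : U) : Ω) from rfl, this]
      exact hKs fun hx => hω ⟨_, hx, rfl⟩
    · rw [Function.extend_apply' _ _ _ (by rintro ⟨x, rfl⟩; exact hU x.2)]
      simpa using hε
  { toFun := Function.extend (Subtype.val : U → Ω) f 0
    continuous_toFun := by
      rw [continuous_iff_continuousAt]
      intro ω
      by_cases hU : ω ∈ U
      · have ho : Topology.IsOpenEmbedding (Subtype.val : U → Ω) :=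
          U.isOpen.isOpenEmbedding_subtypeVal
        refine (ho.continuousAt_iff (x := (⟨ω, hU⟩ : U))).1 ?_
        rw [Function.extend_comp Subtype.val_injective]
        exact (map_continuous f).continuousAt
      · have h0 : Function.extend (Subtype.val : U → Ω) f 0 ω = 0 :=
          Function.extend_apply' _ _ _ (by rintro ⟨x, rfl⟩; exact hU x.2)
        rw [ContinuousAt, h0, Metric.tendsto_nhds]
        intro ε hε
        obtain ⟨K, hK, hKU, hKs⟩ := small ε hε
        filter_upwards [hK.isClosed.isOpen_compl.mem_nhds fun h => hU (hKU h)] with x hx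
        simpa using hKs x hx
    zero_at_infty' := by
      rw [Metric.tendsto_nhds]
      intro ε hε
      obtain ⟨K, hK, -, hKs⟩ := small ε hε
      filter_upwards [hK.compl_mem_cocompact] with x hx
      simpa using hKs x hx }

theorem extendZero_apply (U : Opens Ω) (f : C₀(U, ℂ)) (ω : U) : extendZero U f ω = f ω :=
  Subtype.val_injective.extend_apply _ _ _

theorem extendZero_apply_of_notMem (U : Opens Ω) (f : C₀(U, ℂ)) {ω : Ω} (hω : ω ∉ U) :
    extendZero U f ω = 0 :=
  Function.extend_apply' _ _ _ (by rintro ⟨x, rfl⟩; exact hω x.2)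

variable (E : Type*) [NormedAddCommGroup E] [NormedSpace ℂ E] [SMul C₀(Ω, ℂ) E]
  [CStarModule C₀(Ω, ℂ) E]

/-- `E_U`: the `C₀`-sections over the open set `U`, identified with the elements of `E` that
vanish outside `U`. -/
abbrev restrict (U : Opens Ω) : Submodule ℂ E := vanishingOn E (U : Set Ω)ᶜ

/-- The action of `C₀(U)` on `E_U`: the section `f • e` has the value `f(ω) e(ω)` at `ω ∈ U`. -/
instance (U : Opens Ω) : SMul C₀(U, ℂ) (restrict E U) where
  smul f e := ⟨extendZero U f • (e : E), fun ω hω => by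
    rw [CStarModule.inner_op_smul_right, CStarModule.inner_op_smul_left]
    simp [e.2 ω hω]⟩

theorem coe_smul_restrict (U : Opens Ω) (f : C₀(U, ℂ)) (e : restrict E U) :
    ((f • e : restrict E U) : E) = extendZero U f • (e : E) := rfl

end Restriction

section Support

variable (Ω) {E F : Type*} [NormedAddCommGroup E] [NormedSpace ℂ E]
  [NormedAddCommGroup F] [NormedSpace ℂ F] [SMul C₀(Ω, ℂ) F] [CStarModule C₀(Ω, ℂ) F]

/-- `Ω_θ`: the open set of points `ω` with `θ(e)(ω) ≠ 0` for some `e`. -/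
def nonzeroSet (θ : E →ₗ[ℂ] F) : Opens Ω where
  carrier := {ω | ∃ e : E, value ω (θ e) ≠ 0}
  is_open' := by
    have : {ω : Ω | ∃ e : E, value ω (θ e) ≠ 0} =
        ⋃ e : E, {ω | inner C₀(Ω, ℂ) (θ e) (θ e) ω ≠ 0} := by
      ext ω
      simp [value_eq_zero_iff]
    rw [this]
    exact isOpen_iUnion fun e => isOpen_ne_fun (map_continuous _) continuous_const

end Support

end HilbertC0

end

noncomputable section

namespace HilbertC0

section Basic

variable {Ω : Type*} [TopologicalSpace Ω]

/-! ### Sections and their values in the fibres -/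

section Values

variable {E : Type*} [NormedAddCommGroup E] [NormedSpace ℂ E] [SMul C₀(Ω, ℂ) E]
  [CStarModule C₀(Ω, ℂ) E]

/-! No continuity of `θ` is assumed; locality supplies it through a gliding hump. If `θ` were large
on sections of size about one at points of pairwise disjoint open sets, damped bumps of these
sections would sum to a single section `S`. By locality `θ S` agrees with the damped large values at
those points, which contradicts `‖θ S‖ < ∞` (`IsLocalMap.bddAbove_of_le`).

Applied to `1 / ‖e(x)‖`, this shows that `e(ω) = 0` forces `θ(e)(ω) = 0`, so `θ` acts fibrewise and
is therefore `C₀(Ω)`-linear. Orthogonal vectors of a fibre lift, up to a scalar, to orthogonal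
sections, so each fibre map preserves orthogonality and multiplies the inner product by a constant
`ψ(ω)²` (`exists_inner_map_eq_mul`). Locally on `Ω_E`, `ψ` is a quotient of continuous norms, and a
second gliding hump bounds it. This gives (a) and (b) with `φ = ψ²`.

For (c), `J` is `ψ⁻¹ θ`. Although `ψ⁻¹` may be unbounded, `ψ⁻¹ θ(g)` is dominated by `g`, so cutting
off yields sections converging uniformly to it (`exists_section_smul`). -/

theorem inner_value (ω : Ω) (e g : E) :
    inner ℂ (value ω e) (value ω g) = inner C₀(Ω, ℂ) e g ω :=
  fibreInner_value ω e g

theorem norm_value_sq (ω : Ω) (e : E) :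
    (‖value ω e‖ : ℂ) ^ 2 = inner C₀(Ω, ℂ) e e ω := by
  rw [← inner_value]
  exact (inner_self_eq_norm_sq_to_K (value ω e)).symm

theorem norm_value_sq_eq_norm (ω : Ω) (e : E) :
    ‖value ω e‖ ^ 2 = ‖inner C₀(Ω, ℂ) e e ω‖ := by
  rw [← norm_value_sq, norm_pow, Complex.norm_real, norm_norm]

theorem norm_value_eq_sqrt (ω : Ω) (e : E) :
    ‖value ω e‖ = √‖inner C₀(Ω, ℂ) e e ω‖ := by
  rw [← norm_value_sq_eq_norm, Real.sqrt_sq (norm_nonneg _)]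

theorem continuous_norm_value (e : E) : Continuous fun ω : Ω => ‖value ω e‖ := by
  simp_rw [norm_value_eq_sqrt]
  exact (map_continuous _).norm.sqrt

theorem norm_value_le (ω : Ω) (e : E) : ‖value ω e‖ ≤ ‖e‖ := by
  rw [norm_value_eq_sqrt, CStarModule.norm_eq_sqrt_norm_inner_self (A := C₀(Ω, ℂ)) e]
  exact Real.sqrt_le_sqrt ((inner C₀(Ω, ℂ) e e).toBCF.norm_coe_le_norm ω)

variable (Ω) in
/-- The norm of a section is at most any bound of the norms of its values. -/
theorem norm_le_of_norm_value_le {e : E} {C : ℝ} (hC : 0 ≤ C)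
    (h : ∀ ω : Ω, ‖value ω e‖ ≤ C) : ‖e‖ ≤ C := by
  rw [CStarModule.norm_eq_sqrt_norm_inner_self (A := C₀(Ω, ℂ)) e]
  refine Real.sqrt_le_iff.2 ⟨hC, ?_⟩
  refine ((inner C₀(Ω, ℂ) e e).toBCF.norm_le (sq_nonneg C)).2 fun ω => ?_
  refine (norm_value_sq_eq_norm ω e).symm.trans_le ?_
  gcongr
  exact h ω

variable (Ω) in
theorem ext_value {e g : E} (h : ∀ ω : Ω, value ω e = value ω g) : e = g := by
  have : ‖e - g‖ ≤ 0 := norm_le_of_norm_value_le Ω le_rfl fun ω => by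
    rw [map_sub, h, sub_self, norm_zero]
  exact sub_eq_zero.1 (norm_le_zero_iff.1 this)

/-- The action is only an `SMul`, so the rule must come from the inner product: the square of `a e -
a(ω) e` expands to zero at `ω`. -/
theorem value_smul (ω : Ω) (a : C₀(Ω, ℂ)) (e : E) : value ω (a • e) = a ω • value ω e := by
  rw [← map_smul, value_eq_value_iff]
  simp only [CStarModule.inner_sub_left, CStarModule.inner_sub_right,
    CStarModule.inner_op_smul_left, CStarModule.inner_op_smul_right,
    CStarModule.inner_smul_left_complex, CStarModule.inner_smul_right_complex,
    ZeroAtInftyContinuousMap.sub_apply, ZeroAtInftyContinuousMap.mul_apply,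
    ZeroAtInftyContinuousMap.smul_apply, ZeroAtInftyContinuousMap.star_apply, smul_eq_mul]
  ring

/-- Evaluation at `ω` as a continuous linear map. -/
def valueL (ω : Ω) : E →L[ℂ] Fibre E ω :=
  (value ω).mkContinuous 1 fun e => by rw [one_mul]; exact norm_value_le ω e

theorem mem_nonzeroFibres_iff {ω : Ω} : ω ∈ nonzeroFibres Ω E ↔ ∃ e : E, value ω e ≠ 0 := by
  constructor
  · intro h
    obtain ⟨ξ, hξ⟩ := @exists_ne _ h (0 : Fibre E ω)
    obtain ⟨e, rfl⟩ := value_surjective ω ξ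
    exact ⟨e, hξ⟩
  · rintro ⟨e, he⟩
    exact ⟨_, _, he⟩

theorem isOpen_nonzeroFibres : IsOpen (nonzeroFibres Ω E) := by
  have : nonzeroFibres Ω E = ⋃ e : E, {ω | ‖value ω e‖ ≠ 0} := by
    ext ω
    simp [mem_nonzeroFibres_iff]
  rw [this]
  exact isOpen_iUnion fun e => isOpen_ne_fun (continuous_norm_value e) continuous_const

/-- A family of vectors that is a uniform limit of sections is a section. -/
theorem exists_section_of_approx [CompleteSpace E] (s : ∀ ω : Ω, Fibre E ω)
    (h : ∀ ε > 0, ∃ x : E, ∀ ω, ‖value ω x - s ω‖ ≤ ε) : ∃ x : E, ∀ ω, value ω x = s ω := by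
  choose x hx using fun n : ℕ => h ((1 / 2 : ℝ) ^ n) (by positivity)
  have hlim : Filter.Tendsto (fun n : ℕ => (1 / 2 : ℝ) ^ n) Filter.atTop (nhds 0) :=
    tendsto_pow_atTop_nhds_zero_of_lt_one (by norm_num) (by norm_num)
  have hc : CauchySeq x := by
    refine cauchySeq_of_le_tendsto_0 (fun n => (1 / 2 : ℝ) ^ n + (1 / 2 : ℝ) ^ n) ?_
      (by simpa using hlim.add hlim)
    intro n m N hn hm
    rw [dist_eq_norm]
    refine norm_le_of_norm_value_le Ω (by positivity) fun ω => ?_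
    rw [map_sub, ← sub_sub_sub_cancel_right _ _ (s ω)]
    have mono : ∀ k, N ≤ k → (1 / 2 : ℝ) ^ k ≤ (1 / 2 : ℝ) ^ N := fun k hk =>
      pow_le_pow_of_le_one (by norm_num) (by norm_num) hk
    exact (norm_sub_le _ _).trans
      (add_le_add ((hx n ω).trans (mono n hn)) ((hx m ω).trans (mono m hm)))
  obtain ⟨y, hy⟩ := cauchySeq_tendsto_of_complete hc
  refine ⟨y, fun ω => ?_⟩
  have h1 : Filter.Tendsto (fun n => value ω (x n)) Filter.atTop (nhds (value ω y)) :=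
    ((valueL ω).continuous.tendsto y).comp hy
  have h2 : Filter.Tendsto (fun n => value ω (x n)) Filter.atTop (nhds (s ω)) :=
    tendsto_iff_norm_sub_tendsto_zero.2
      (squeeze_zero (fun _ => norm_nonneg _) (fun n => hx n ω) hlim)
  exact tendsto_nhds_unique h1 h2

end Values

/-! ### Bump functions -/

section Urysohn

variable [LocallyCompactSpace Ω] [T2Space Ω]

/-- A Urysohn function in `C₀(Ω)` that is `1` near a point of an open set `U` and vanishes
outside `U`. -/
theorem exists_bump {U : Set Ω} (hU : IsOpen U) {w : Ω} (hw : w ∈ U) :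
    ∃ (b : C₀(Ω, ℂ)) (V : Set Ω), IsOpen V ∧ w ∈ V ∧ V ⊆ U ∧ (∀ x ∈ V, b x = 1) ∧
      (∀ x, ‖b x‖ ≤ 1) ∧ ∀ x ∉ U, b x = 0 := by
  obtain ⟨K, hK, hwK, hKU⟩ := exists_compact_subset hU hw
  obtain ⟨f, hf1, hf0, hfc, hfI⟩ := exists_continuous_one_zero_of_isCompact hK hU.isClosed_compl
    (Set.disjoint_compl_right_iff_subset.2 hKU)
  have hc : HasCompactSupport fun x => (f x : ℂ) := hfc.comp_left Complex.ofReal_zero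
  refine ⟨⟨⟨fun x => (f x : ℂ), by fun_prop⟩, hc.is_zero_at_infty⟩, interior K, isOpen_interior,
    hwK, interior_subset.trans hKU, fun x hx => ?_, fun x => ?_, fun x hx => ?_⟩
  · change (f x : ℂ) = 1
    rw [hf1 (interior_subset hx)]
    simp
  · change ‖(f x : ℂ)‖ ≤ 1
    rw [Complex.norm_real, Real.norm_eq_abs, abs_of_nonneg (hfI x).1]
    exact (hfI x).2
  · change (f x : ℂ) = 0
    rw [hf0 hx]
    simp

end Urysohn

/-! ### Local maps and the gliding hump -/

section Local

variable [LocallyCompactSpace Ω] [T2Space Ω]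
  {E F : Type*} [NormedAddCommGroup E] [NormedSpace ℂ E]
  [SMul C₀(Ω, ℂ) E] [CStarModule C₀(Ω, ℂ) E]
  [NormedAddCommGroup F] [NormedSpace ℂ F]
  [SMul C₀(Ω, ℂ) F] [CStarModule C₀(Ω, ℂ) F]
  {θ : E →ₗ[ℂ] F}

/-- A bump `b` supported in `U` with `b(w) = 1` kills `e` everywhere, hence kills `θ(e)`. -/
theorem IsLocalMap.value_eq_zero (hlocal : IsLocalMap C₀(Ω, ℂ) θ) {U : Set Ω} (hU : IsOpen U)
    {w : Ω} (hw : w ∈ U) {e : E} (h : ∀ x ∈ U, value x e = 0) : value w (θ e) = 0 := by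
  obtain ⟨b, V, -, hwV, -, hb1, -, hb0⟩ := exists_bump hU hw
  have hbe : b • e = 0 := ext_value Ω fun x => by
    rw [value_smul, map_zero]
    by_cases hx : x ∈ U
    · rw [h x hx, smul_zero]
    · rw [hb0 x hx, zero_smul]
  have := congrArg (value w) (hlocal e b hbe)
  rwa [value_smul, hb1 w hwV, one_smul, map_zero] at this

theorem IsLocalMap.value_congr (hlocal : IsLocalMap C₀(Ω, ℂ) θ) {U : Set Ω} (hU : IsOpen U)
    {w : Ω} (hw : w ∈ U) {e g : E} (h : ∀ x ∈ U, value x e = value x g) :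
    value w (θ e) = value w (θ g) := by
  rw [← sub_eq_zero, ← map_sub, ← map_sub]
  exact hlocal.value_eq_zero hU hw fun x hx => by rw [map_sub, h x hx, sub_self]

/-- A local map is bounded along summable sections over disjoint open sets. -/
theorem IsLocalMap.bounded_of_disjoint [CompleteSpace E] (hlocal : IsLocalMap C₀(Ω, ℂ) θ)
    {U : ℕ → Set Ω} (hU : ∀ n, IsOpen (U n)) (hd : Pairwise fun n m => Disjoint (U n) (U m))
    {w : ℕ → Ω} (hw : ∀ n, w n ∈ U n) {e : ℕ → E} {r : ℕ → ℝ} (hr : Summable r)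
    (hr0 : ∀ n, 0 ≤ r n) (he : ∀ n, ∀ x ∈ U n, ‖value x (e n)‖ ≤ r n) :
    ∃ C : ℝ, ∀ n, ‖value (w n) (θ (e n))‖ ≤ C := by
  choose b V hV hwV hVU hb1 hble hb0 using fun n => exists_bump (hU n) (hw n)
  have hnorm : ∀ n, ‖b n • e n‖ ≤ r n := fun n =>
    norm_le_of_norm_value_le Ω (hr0 n) fun x => by
      rw [value_smul, norm_smul]
      by_cases hx : x ∈ U n
      · exact (mul_le_of_le_one_left (norm_nonneg _) (hble n x)).trans (he n x hx)
      · rw [hb0 n x hx, norm_zero, zero_mul]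
        exact hr0 n
  -- On `V n` only the `n`-th term of the sum survives, so `‖θ S‖` bounds all the values at once.
  obtain ⟨S, hS⟩ : Summable fun n => b n • e n := Summable.of_norm_bounded hr hnorm
  refine ⟨‖θ S‖, fun n => ?_⟩
  have : value (w n) (θ (e n)) = value (w n) (θ S) := by
    refine hlocal.value_congr (hV n) (hwV n) fun x hx => ?_
    have h1 : HasSum (fun m => value x (b m • e m)) (value x S) := (valueL x).hasSum hS
    have h2 : HasSum (fun m => value x (b m • e m)) (value x (b n • e n)) :=
      hasSum_single n fun m hm => by
        rw [value_smul, hb0 m x fun hxm => (hd hm).le_bot ⟨hxm, hVU n hx⟩, zero_smul]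
    rw [h1.unique h2, value_smul, hb1 n x hx, one_smul]
  rw [this]
  exact norm_value_le _ _

/-- A function `t` that bounds the size of a local map from below is bounded. -/
theorem IsLocalMap.bddAbove_of_le [CompleteSpace E] (hlocal : IsLocalMap C₀(Ω, ℂ) θ)
    {S : Set Ω} (hS : IsOpen S) {t : Ω → ℝ} (ht : ContinuousOn t S) {δ : ℝ} (hδ : 0 < δ)
    (h : ∀ w ∈ S, ∃ e : E, ‖value w e‖ ≤ 1 ∧ δ * t w ≤ ‖value w (θ e)‖) :
    ∃ C : ℝ, ∀ w ∈ S, t w ≤ C := by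
  by_contra! hC
  -- Fourfold growth makes the intervals `(t/2, 2t)` disjoint; the bound `4 ^ n` outgrows the
  -- damping `2⁻ⁿ` used below.
  obtain ⟨w, hw⟩ : ∃ w : ℕ → Ω, ∀ n, (w n ∈ S ∧ (4 : ℝ) ^ n < t (w n)) ∧
      4 * t (w n) < t (w (n + 1)) := by
    choose p hpS hp using hC
    let w : ℕ → Ω := fun n => Nat.rec (p 1) (fun n x => p (max (4 * t x) (4 ^ (n + 1)))) n
    have hsucc : ∀ n, w (n + 1) = p (max (4 * t (w n)) (4 ^ (n + 1))) := fun n => rfl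
    refine ⟨w, fun n => ⟨?_, ?_⟩⟩
    · cases n with
      | zero => exact ⟨hpS 1, (pow_zero (4 : ℝ)).trans_lt (hp 1)⟩
      | succ n =>
        rw [hsucc]
        exact ⟨hpS _, (le_max_right _ _).trans_lt (hp _)⟩
    · rw [hsucc]
      exact (le_max_left _ _).trans_lt (hp _)
  have hpos : ∀ n, 0 < t (w n) := fun n => (by positivity : (0 : ℝ) < 4 ^ n).trans (hw n).1.2
  have hlt : ∀ n m, n < m → 4 * t (w n) < t (w m) := by
    intro n m hnm
    induction m, hnm using Nat.le_induction with
    | base => exact (hw n).2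
    | succ m _ ih => linarith [(hw m).2, hpos m]
  choose e he1 heθ using fun n => h (w n) (hw n).1.1
  -- The second factor keeps `e n` below `2`, so that the damped pieces are summable.
  let U : ℕ → Set Ω := fun n =>
    (S ∩ t ⁻¹' Set.Ioo (t (w n) / 2) (2 * t (w n))) ∩ {x | ‖value x (e n)‖ < 2}
  have hU : ∀ n, IsOpen (U n) := fun n =>
    (ht.isOpen_inter_preimage hS isOpen_Ioo).inter
      (isOpen_lt (continuous_norm_value _) continuous_const)
  have hwU : ∀ n, w n ∈ U n := fun n =>
    ⟨⟨(hw n).1.1, by have := hpos n; constructor <;> linarith⟩, (he1 n).trans_lt one_lt_two⟩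
  have hd' : ∀ n m, n < m → Disjoint (U n) (U m) := fun n m hnm =>
    Set.disjoint_left.2 fun x hn hm => by
      have h1 := hn.1.2.2
      have h2 := hm.1.2.1
      linarith [hlt n m hnm]
  have hd : Pairwise fun n m => Disjoint (U n) (U m) := fun n m hnm =>
    hnm.lt_or_gt.elim (hd' n m) fun h => (hd' m n h).symm
  obtain ⟨C, hC⟩ := hlocal.bounded_of_disjoint hU hd hwU
    (e := fun n => ((1 / 2 : ℝ) ^ n : ℂ) • e n) (r := fun n => (1 / 2 : ℝ) ^ n * 2)
    (summable_geometric_two.mul_right 2) (fun n => by positivity) (fun n x hx => by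
      rw [map_smul, norm_smul]
      refine mul_le_mul (le_of_eq ?_) hx.2.le (norm_nonneg _) (by positivity)
      simp)
  obtain ⟨n, hn⟩ := pow_unbounded_of_one_lt (C / δ) (one_lt_two : (1 : ℝ) < 2)
  have h1 := hC n
  rw [map_smul, map_smul, norm_smul] at h1
  have h2 : ‖((1 / 2 : ℝ) ^ n : ℂ)‖ = (1 / 2 : ℝ) ^ n := by simp
  rw [h2] at h1
  rw [div_lt_iff₀ hδ] at hn
  have h3 : (1 / 2 : ℝ) ^ n * (δ * 4 ^ n) ≤ C :=
    (mul_le_mul_of_nonneg_left ((mul_le_mul_of_nonneg_left (hw n).1.2.le hδ.le).trans (heθ n))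
      (by positivity)).trans h1
  have h4 : (1 / 2 : ℝ) ^ n * (δ * 4 ^ n) = 2 ^ n * δ := by
    rw [mul_left_comm, ← mul_pow, mul_comm]
    norm_num
  linarith

/-- A local map descends to the fibres. -/
theorem IsLocalMap.value_eq_zero_of_value_eq_zero [CompleteSpace E]
    (hlocal : IsLocalMap C₀(Ω, ℂ) θ) {ω : Ω} {e : E} (h : value ω e = 0) :
    value ω (θ e) = 0 := by
  by_contra hne
  set δ := ‖value ω (θ e)‖ / 2 with hδ
  have hδ0 : 0 < δ := half_pos (norm_pos_iff.2 hne)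
  have hδω : δ < ‖value ω (θ e)‖ := half_lt_self (norm_pos_iff.2 hne)
  have hV : IsOpen {x : Ω | δ < ‖value x (θ e)‖} :=
    isOpen_lt continuous_const (continuous_norm_value _)
  have hS : IsOpen {x : Ω | ‖value x e‖ ≠ 0} :=
    isOpen_ne_fun (continuous_norm_value _) continuous_const
  -- Normalising `e` at `x` scales `θ(e)(x)`, of size above `δ`, by `1 / ‖e(x)‖`.
  obtain ⟨C, hC⟩ := hlocal.bddAbove_of_le (hV.inter hS) (t := fun x => ‖value x e‖⁻¹)
    ((continuous_norm_value e).continuousOn.inv₀ fun x hx => hx.2) hδ0 (fun x hx => by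
      refine ⟨((‖value x e‖⁻¹ : ℝ) : ℂ) • e, ?_, ?_⟩
      · rw [map_smul, norm_smul, Complex.norm_real, norm_inv, norm_norm]
        exact inv_mul_le_one
      · rw [map_smul, map_smul, norm_smul, Complex.norm_real, norm_inv, norm_norm, mul_comm]
        exact mul_le_mul_of_nonneg_left hx.1.le (by positivity))
  -- A nonzero value this small would violate the bound `C`, so `e` vanishes near `ω`; the `1` only
  -- ensures positivity.
  have hW : IsOpen {x : Ω | ‖value x e‖ < (max C 1)⁻¹} :=
    isOpen_lt (continuous_norm_value _) continuous_const
  have hm : 0 < max C 1 := lt_max_of_lt_right one_pos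
  refine hne (hlocal.value_eq_zero (hV.inter hW) ⟨hδω, ?_⟩ fun x hx => ?_)
  · change ‖value ω e‖ < _
    rw [h, norm_zero]
    exact inv_pos.2 hm
  · by_contra hx0
    have hx0' : 0 < ‖value x e‖ := norm_pos_iff.2 hx0
    have h1 := hC x ⟨hx.1, hx0'.ne'⟩
    have h2 : max C 1 < ‖value x e‖⁻¹ := (lt_inv_comm₀ hm hx0').2 hx.2
    exact absurd (le_max_left C 1) (not_le.2 (h2.trans_le h1))

end Local

end Basic

/-! ### Orthogonality preserving maps of inner product spaces -/

/-- A linear map between inner product spaces that preserves orthogonality multiplies the inner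
product by a constant. -/
theorem exists_inner_map_eq_mul {H K : Type*} [NormedAddCommGroup H] [InnerProductSpace ℂ H]
    [NormedAddCommGroup K] [InnerProductSpace ℂ K] (T : H →ₗ[ℂ] K)
    (hT : ∀ x y : H, inner ℂ x y = 0 → inner ℂ (T x) (T y) = 0) :
    ∃ c : ℝ, 0 ≤ c ∧ ∀ x y : H, inner ℂ (T x) (T y) = c * inner ℂ x y := by
  -- Gram–Schmidt without division: `⟨x,x⟩ y - ⟨x,y⟩ x` is orthogonal to `x`.
  have key : ∀ x y : H, inner ℂ (T x) (T y) * inner ℂ x x =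
      inner ℂ (T x) (T x) * inner ℂ x y := by
    intro x y
    have h := hT x (inner ℂ x x • y - inner ℂ x y • x) (by
      rw [inner_sub_right, inner_smul_right, inner_smul_right]; ring)
    rw [map_sub, map_smul, map_smul, inner_sub_right, inner_smul_right, inner_smul_right,
      sub_eq_zero] at h
    rw [mul_comm, h, mul_comm]
  by_cases hH : ∃ e : H, e ≠ 0
  swap
  · push Not at hH
    exact ⟨0, le_rfl, fun x y => by simp [hH x]⟩
  obtain ⟨e, he⟩ := hH
  have hs : (inner ℂ e e : ℂ) ≠ 0 := inner_self_ne_zero.2 he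
  -- For `z ⊥ e`, the vectors `⟨z,z⟩ e + z` and `e - ⟨e,e⟩ z` are orthogonal; orthogonality of their
  -- images compares `‖T z‖` with `‖T e‖`.
  have perp : ∀ z : H, inner ℂ e z = 0 →
      inner ℂ (T z) (T z) * inner ℂ e e = inner ℂ (T e) (T e) * inner ℂ z z := by
    intro z hz
    have hz' : inner ℂ z e = 0 := inner_eq_zero_symm.1 hz
    have hconj : (starRingEnd ℂ) (inner ℂ z z) = inner ℂ z z := inner_conj_symm z z
    have h := hT ((inner ℂ z z : ℂ) • e + z) (e - (inner ℂ e e : ℂ) • z) (by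
      simp only [inner_sub_right, inner_add_left, inner_smul_left, inner_smul_right, hz, hz',
        hconj]
      ring)
    simp only [map_add, map_sub, map_smul, inner_sub_right, inner_add_left, inner_smul_left,
      inner_smul_right, hT e z hz, hT z e hz', hconj] at h
    linear_combination -h
  have diag : ∀ x : H,
      inner ℂ (T x) (T x) * inner ℂ e e = inner ℂ (T e) (T e) * inner ℂ x x := by
    intro x
    obtain ⟨α, z, hz, rfl⟩ : ∃ (α : ℂ) (z : H), inner ℂ e z = 0 ∧ x = α • e + z :=
      ⟨inner ℂ e x / inner ℂ e e, x - (inner ℂ e x / inner ℂ e e : ℂ) • e, by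
        rw [inner_sub_right, inner_smul_right, div_mul_cancel₀ _ hs, sub_self], by abel⟩
    have hz' : inner ℂ z e = 0 := inner_eq_zero_symm.1 hz
    simp only [map_add, map_smul, inner_add_right, inner_add_left, inner_smul_left,
      inner_smul_right, hz, hz', hT e z hz, hT z e hz']
    linear_combination perp z hz
  refine ⟨‖T e‖ ^ 2 / ‖e‖ ^ 2, by positivity, fun x y => ?_⟩
  have hc : ((‖T e‖ ^ 2 / ‖e‖ ^ 2 : ℝ) : ℂ) = inner ℂ (T e) (T e) / inner ℂ e e := by
    rw [inner_self_eq_norm_sq_to_K, inner_self_eq_norm_sq_to_K]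
    push_cast
    rfl
  rw [hc]
  by_cases hx : x = 0
  · simp [hx]
  have hxx : (inner ℂ x x : ℂ) ≠ 0 := inner_self_ne_zero.2 hx
  rw [div_mul_eq_mul_div, eq_div_iff hs]
  refine mul_right_cancel₀ hxx ?_
  linear_combination inner ℂ e e * key x y + inner ℂ x y * diag x

/-! ### Fibre maps and the scaling function -/

section OrthogonalityPreserving

variable {Ω : Type*} [TopologicalSpace Ω] [LocallyCompactSpace Ω] [T2Space Ω]
  {E F : Type*} [NormedAddCommGroup E] [NormedSpace ℂ E] [CompleteSpace E]
  [SMul C₀(Ω, ℂ) E] [CStarModule C₀(Ω, ℂ) E]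
  [NormedAddCommGroup F] [NormedSpace ℂ F]
  [SMul C₀(Ω, ℂ) F] [CStarModule C₀(Ω, ℂ) F]
  {θ : E →ₗ[ℂ] F}

/-- The map induced by a local map on the fibres. -/
def IsLocalMap.fibreMap (hlocal : IsLocalMap C₀(Ω, ℂ) θ) (ω : Ω) :
    Fibre E ω →ₗ[ℂ] Fibre F ω :=
  (vanishingOn E ({ω} : Set Ω)).liftQ ((value ω).comp θ) fun _ he =>
    hlocal.value_eq_zero_of_value_eq_zero (value_eq_zero_iff.2 (he ω rfl))

theorem IsLocalMap.fibreMap_value (hlocal : IsLocalMap C₀(Ω, ℂ) θ) (ω : Ω) (e : E) :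
    hlocal.fibreMap ω (value ω e) = value ω (θ e) :=
  Submodule.liftQ_apply _ _ _

theorem IsLocalMap.value_map_congr (hlocal : IsLocalMap C₀(Ω, ℂ) θ) {ω : Ω} {e g : E}
    (h : value ω e = value ω g) : value ω (θ e) = value ω (θ g) := by
  rw [← hlocal.fibreMap_value, h, hlocal.fibreMap_value]

/-- At `ω` the sections `a e` and `a(ω) e` have the same value, so complex linearity suffices. -/
theorem IsLocalMap.map_smul_C0 (hlocal : IsLocalMap C₀(Ω, ℂ) θ) (a : C₀(Ω, ℂ)) (e : E) :
    θ (a • e) = a • θ e := ext_value Ω fun ω => by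
  rw [value_smul, ← map_smul, ← map_smul]
  exact hlocal.value_map_congr (by rw [value_smul, map_smul])

/-- The fibre maps of a local orthogonality preserving map preserve orthogonality. -/
theorem IsLocalMap.inner_fibreMap_eq_zero (hlocal : IsLocalMap C₀(Ω, ℂ) θ)
    (horth : IsOrthogonalityPreserving C₀(Ω, ℂ) θ) {ω : Ω} {ξ η : Fibre E ω}
    (h : inner ℂ ξ η = 0) : inner ℂ (hlocal.fibreMap ω ξ) (hlocal.fibreMap ω η) = 0 := by
  by_cases hξ : ξ = 0
  · simp [hξ]
  obtain ⟨x, rfl⟩ := value_surjective ω ξ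
  obtain ⟨y, rfl⟩ := value_surjective ω η
  have hxx : (inner ℂ (value ω x) (value ω x) : ℂ) ≠ 0 := inner_self_ne_zero.2 hξ
  -- Orthogonal to `x` over all of `Ω`, while at `ω` it is a nonzero multiple of `y(ω)`.
  set y' : E := inner C₀(Ω, ℂ) x x • y - inner C₀(Ω, ℂ) x y • x with hy'
  have h0 : inner C₀(Ω, ℂ) x y' = 0 := by
    rw [hy', CStarModule.inner_sub_right, CStarModule.inner_op_smul_right,
      CStarModule.inner_op_smul_right, mul_comm, sub_self]
  have hval : value ω y' = (inner ℂ (value ω x) (value ω x) : ℂ) • value ω y := by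
    rw [hy', map_sub, value_smul, value_smul, ← inner_value, ← inner_value, h, zero_smul,
      sub_zero]
  have h1 : inner ℂ (hlocal.fibreMap ω (value ω x)) (hlocal.fibreMap ω (value ω y')) = 0 := by
    rw [hlocal.fibreMap_value, hlocal.fibreMap_value, inner_value, horth x y' h0]
    rfl
  rw [hval, map_smul, inner_smul_right] at h1
  exact (mul_eq_zero.1 h1).resolve_left hxx

/-- The scaling function of a local orthogonality preserving map. -/
theorem IsLocalMap.exists_scaling (hlocal : IsLocalMap C₀(Ω, ℂ) θ)
    (horth : IsOrthogonalityPreserving C₀(Ω, ℂ) θ) :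
    ∃ ψ : Ω → ℝ, (∀ ω, 0 ≤ ψ ω) ∧ (∃ C, ∀ ω, ψ ω ≤ C) ∧ ContinuousOn ψ (nonzeroFibres Ω E) ∧
      ∀ ω (ξ η : Fibre E ω), inner ℂ (hlocal.fibreMap ω ξ) (hlocal.fibreMap ω η) =
        (ψ ω : ℂ) ^ 2 * inner ℂ ξ η := by
  classical
  choose c hc0 hc using fun ω => exists_inner_map_eq_mul (hlocal.fibreMap ω)
    fun ξ η => hlocal.inner_fibreMap_eq_zero horth
  have hsq : ∀ ω, ((√(c ω) : ℝ) : ℂ) ^ 2 = c ω := fun ω => by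
    rw [← Complex.ofReal_pow, Real.sq_sqrt (hc0 ω)]
  have hnorm : ∀ ω (e : E), ‖value ω (θ e)‖ = √(c ω) * ‖value ω e‖ := fun ω e => by
    have h := hc ω (value ω e) (value ω e)
    rw [hlocal.fibreMap_value, inner_value, inner_value, ← norm_value_sq, ← norm_value_sq,
      ← hsq ω, ← mul_pow] at h
    have h' : ‖value ω (θ e)‖ ^ 2 = (√(c ω) * ‖value ω e‖) ^ 2 := by
      exact_mod_cast h
    exact (sq_eq_sq₀ (norm_nonneg _) (by positivity)).1 h'
  have hcont : ContinuousOn (fun ω => √(c ω)) (nonzeroFibres Ω E) := by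
    intro ω hω
    obtain ⟨e, he⟩ := mem_nonzeroFibres_iff.1 hω
    have he' : ‖value ω e‖ ≠ 0 := norm_ne_zero_iff.2 he
    have hev : ∀ᶠ x in nhds ω, ‖value x e‖ ≠ 0 :=
      (continuous_norm_value e).continuousAt.eventually_ne he'
    refine ContinuousAt.continuousWithinAt ?_
    refine ((continuous_norm_value (θ e)).continuousAt.div
      (continuous_norm_value e).continuousAt he').congr ?_
    filter_upwards [hev] with x hx
    simp only [Pi.div_apply, hnorm x e]
    exact mul_div_cancel_right₀ _ hx
  -- Unit vectors attain the scaling factor, so the gliding hump applies with `δ = 1`.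
  obtain ⟨C, hC⟩ := hlocal.bddAbove_of_le isOpen_nonzeroFibres hcont one_pos (fun w hw => by
    obtain ⟨e, he⟩ := mem_nonzeroFibres_iff.1 hw
    have he1 : ‖value w (((‖value w e‖⁻¹ : ℝ) : ℂ) • e)‖ = 1 := by
      rw [map_smul, norm_smul, Complex.norm_real, norm_inv, norm_norm]
      exact inv_mul_cancel₀ (norm_ne_zero_iff.2 he)
    exact ⟨_, he1.le, by rw [hnorm, he1, one_mul, mul_one]⟩)
  -- On a zero fibre the chosen `c ω` is arbitrary; replacing it by `0` keeps the function bounded.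
  refine ⟨fun ω => if ω ∈ nonzeroFibres Ω E then √(c ω) else 0, fun ω => ?_, ⟨max C 0,
    fun ω => ?_⟩, hcont.congr fun ω hω => if_pos hω, fun ω ξ η => ?_⟩
  · dsimp only
    split_ifs
    exacts [Real.sqrt_nonneg _, le_rfl]
  · dsimp only
    split_ifs with h
    exacts [(hC ω h).trans (le_max_left _ _), le_max_right _ _]
  · dsimp only
    split_ifs with h
    · rw [hsq, hc]
    · have hξ : ξ = 0 := by
        by_contra hξ
        exact h ⟨ξ, 0, hξ⟩
      simp [hξ]

end OrthogonalityPreserving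

/-! ### Multiplying sections by functions on an open set -/

theorem isCompact_le_norm_value {Ω E : Type*} [TopologicalSpace Ω] [NormedAddCommGroup E]
    [NormedSpace ℂ E] [SMul C₀(Ω, ℂ) E] [CStarModule C₀(Ω, ℂ) E] (e : E) {ε : ℝ} (hε : 0 < ε) :
    IsCompact {ω : Ω | ε ≤ ‖value ω e‖} := by
  have hlim : Filter.Tendsto (fun ω : Ω => ‖value ω e‖) (Filter.cocompact Ω) (nhds 0) := by
    simp_rw [norm_value_eq_sqrt]
    simpa using (zero_at_infty (inner C₀(Ω, ℂ) e e)).norm.sqrt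
  obtain ⟨K, hK, hKs⟩ := Filter.mem_cocompact.1 (hlim.eventually (gt_mem_nhds hε))
  refine hK.of_isClosed_subset (isClosed_le continuous_const (continuous_norm_value e))
    fun ω hω => ?_
  by_contra h
  exact (lt_irrefl ε) (lt_of_le_of_lt hω (hKs h))

/-- A section may be multiplied by a function `k` continuous on
`U`, provided that the product is bounded by the norm of a section vanishing outside `U`. -/
theorem exists_section_smul {Ω E F : Type*} [TopologicalSpace Ω] [LocallyCompactSpace Ω]
    [T2Space Ω] [NormedAddCommGroup E] [NormedSpace ℂ E]
    [SMul C₀(Ω, ℂ) E] [CStarModule C₀(Ω, ℂ) E]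
    [NormedAddCommGroup F] [NormedSpace ℂ F] [CompleteSpace F]
    [SMul C₀(Ω, ℂ) F] [CStarModule C₀(Ω, ℂ) F]
    {U : Opens Ω} {k : Ω → ℝ} (hk : ContinuousOn k U) {g : E}
    (hg : ∀ ω ∉ U, value ω g = 0) {f : F}
    (hf : ∀ ω, ‖(k ω : ℂ) • value ω f‖ ≤ ‖value ω g‖) :
    ∃ x : F, ∀ ω : Ω, value ω x = (k ω : ℂ) • value ω f := by
  refine exists_section_of_approx _ fun ε hε => ?_
  have hKU : {ω : Ω | ε ≤ ‖value ω g‖} ⊆ U := fun ω hω => by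
    by_contra h
    rw [Set.mem_ofPred_eq, hg ω h, norm_zero] at hω
    exact absurd hε (not_lt.2 hω)
  -- The product `u k` lies in `C₀(Ω)`; the error `(u - 1) k f` is zero where `‖g‖ ≥ ε` and is
  -- dominated by `‖g‖ < ε` elsewhere.
  obtain ⟨u, hu1, huc, huU, huI⟩ := exists_continuousMap_one_of_isCompact_subset_isOpen
    (isCompact_le_norm_value g hε) U.isOpen hKU
  have hsupp : Function.support (fun ω => ((u ω * k ω : ℝ) : ℂ)) ⊆ Function.support u :=
    fun ω hω h => hω (by simp [h])
  have hcont : Continuous fun ω => ((u ω * k ω : ℝ) : ℂ) :=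
    ContinuousOn.continuous_of_tsupport_subset
      (Complex.continuous_ofReal.comp_continuousOn (u.continuous.continuousOn.mul hk)) U.isOpen
      ((closure_mono hsupp).trans huU)
  have hcs : HasCompactSupport fun ω => ((u ω * k ω : ℝ) : ℂ) :=
    huc.of_isClosed_subset (isClosed_tsupport _) (closure_mono hsupp)
  refine ⟨(⟨⟨_, hcont⟩, hcs.is_zero_at_infty⟩ : C₀(Ω, ℂ)) • f, fun ω => ?_⟩
  rw [value_smul]
  change ‖((u ω * k ω : ℝ) : ℂ) • value ω f - (k ω : ℂ) • value ω f‖ ≤ ε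
  by_cases hω : ε ≤ ‖value ω g‖
  · rw [hu1 hω, Pi.one_apply, one_mul, sub_self, norm_zero]
    exact hε.le
  · have : ((u ω * k ω : ℝ) : ℂ) • value ω f - (k ω : ℂ) • value ω f =
        ((u ω - 1 : ℝ) : ℂ) • (k ω : ℂ) • value ω f := by
      rw [smul_smul, ← sub_smul]
      push_cast
      ring_nf
    rw [this, norm_smul, Complex.norm_real, Real.norm_eq_abs]
    have h1 : |u ω - 1| ≤ 1 := abs_le.2 ⟨by linarith [(huI ω).1], by linarith [(huI ω).2]⟩
    exact (mul_le_of_le_one_left (norm_nonneg _) h1).trans ((hf ω).trans (not_le.1 hω).le)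

end HilbertC0

end

/-! ### Proof of the theorem -/

theorem theorem3p5 {Ω E F : Type*} [TopologicalSpace Ω] [LocallyCompactSpace Ω] [T2Space Ω]
    [NormedAddCommGroup E] [NormedSpace ℂ E] [CompleteSpace E]
    [SMul C₀(Ω, ℂ) E] [CStarModule C₀(Ω, ℂ) E]
    [NormedAddCommGroup F] [NormedSpace ℂ F] [CompleteSpace F]
    [SMul C₀(Ω, ℂ) F] [CStarModule C₀(Ω, ℂ) F]
    (θ : E →ₗ[ℂ] F)
    (hlocal : HilbertC0.IsLocalMap C₀(Ω, ℂ) θ)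
    (horth : HilbertC0.IsOrthogonalityPreserving C₀(Ω, ℂ) θ) :
    HilbertC0.IsBoundedModuleMap C₀(Ω, ℂ) θ ∧
    (∃ φ : Ω → ℝ, (∃ C : ℝ, ∀ ω, φ ω ≤ C) ∧ (∀ ω, 0 ≤ φ ω) ∧
      ContinuousOn φ (HilbertC0.nonzeroFibres Ω E) ∧
      ∀ (e g : E) (ω : Ω),
        inner C₀(Ω, ℂ) (θ e) (θ g) ω = (φ ω : ℂ) * inner C₀(Ω, ℂ) e g ω) ∧
    (∃ (ψ₀ : HilbertC0.nonzeroSet Ω θ →ᵇ ℝ)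
      (J : HilbertC0.restrict E (HilbertC0.nonzeroSet Ω θ) →ₗ[ℂ]
        HilbertC0.restrict F (HilbertC0.nonzeroSet Ω θ)),
      (∀ ω, 0 < ψ₀ ω) ∧
      HilbertC0.IsBoundedModuleMap C₀(HilbertC0.nonzeroSet Ω θ, ℂ) J ∧
      ∀ ω : HilbertC0.nonzeroSet Ω θ,
        ∃ Jω : HilbertC0.Fibre E (ω : Ω) →ₗᵢ[ℂ] HilbertC0.Fibre F (ω : Ω),
          (∀ g : HilbertC0.restrict E (HilbertC0.nonzeroSet Ω θ),
            Jω (HilbertC0.value (ω : Ω) (g : E)) = HilbertC0.value (ω : Ω) (J g : F)) ∧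
          ∀ e : E, HilbertC0.value (ω : Ω) (θ e) =
            (ψ₀ ω : ℂ) • Jω (HilbertC0.value (ω : Ω) e)) := by
  open HilbertC0 in
  obtain ⟨ψ, hψ0, ⟨C, hC⟩, hψc, hψ⟩ := hlocal.exists_scaling horth
  have hnormT : ∀ ω (ξ : Fibre E ω), ‖hlocal.fibreMap ω ξ‖ = ψ ω * ‖ξ‖ := fun ω ξ => by
    have h := congrArg norm (hψ ω ξ ξ)
    rw [norm_mul, norm_pow, inner_self_eq_norm_sq_to_K, inner_self_eq_norm_sq_to_K, norm_pow,
      norm_pow, Complex.norm_real, ← mul_pow, Real.norm_of_nonneg (hψ0 ω)] at h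
    simp only [RCLike.norm_ofReal, abs_norm] at h
    exact (sq_eq_sq₀ (norm_nonneg _) (mul_nonneg (hψ0 ω) (norm_nonneg _))).1 h
  have hnorm : ∀ ω (e : E), ‖value ω (θ e)‖ = ψ ω * ‖value ω e‖ := fun ω e => by
    rw [← hlocal.fibreMap_value, hnormT]
  -- `C` itself could be negative when `Ω` is empty.
  have hC0 : 0 ≤ max C 0 := le_max_right _ _
  refine ⟨⟨⟨max C 0, fun e => ?_⟩, hlocal.map_smul_C0⟩, ⟨fun ω => ψ ω ^ 2, ⟨max C 0 ^ 2,
    fun ω => ?_⟩, fun ω => sq_nonneg _, hψc.pow 2, fun e g ω => ?_⟩, ?_⟩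
  · refine norm_le_of_norm_value_le Ω (mul_nonneg hC0 (norm_nonneg _)) fun ω => ?_
    rw [hnorm]
    exact mul_le_mul ((hC ω).trans (le_max_left _ _)) (norm_value_le ω e) (norm_nonneg _) hC0
  · exact pow_le_pow_left₀ (hψ0 ω) ((hC ω).trans (le_max_left _ _)) 2
  · rw [← inner_value, ← inner_value, ← hlocal.fibreMap_value, ← hlocal.fibreMap_value, hψ,
      Complex.ofReal_pow]
  have hpos : ∀ ω ∈ nonzeroSet Ω θ, 0 < ψ ω := by
    rintro ω ⟨e, he⟩
    refine (hψ0 ω).lt_of_ne' fun h => he (norm_eq_zero.1 ?_)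
    rw [hnorm, h, zero_mul]
  have hsub : (nonzeroSet Ω θ : Set Ω) ⊆ nonzeroFibres Ω E := by
    rintro ω ⟨e, he⟩
    refine mem_nonzeroFibres_iff.2 ⟨e, fun h => he ?_⟩
    exact hlocal.value_eq_zero_of_value_eq_zero h
  have hψU : ContinuousOn ψ (nonzeroSet Ω θ) := hψc.mono hsub
  -- Only an inequality, but valid at every point, since the inverse is `0` where `ψ` vanishes.
  have hinv : ∀ ω (ξ : Fibre E ω), ‖((ψ ω)⁻¹ : ℝ) • hlocal.fibreMap ω ξ‖ ≤ ‖ξ‖ := fun ω ξ => by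
    rw [norm_smul, hnormT, Real.norm_of_nonneg (inv_nonneg.2 (hψ0 ω)), ← mul_assoc]
    exact mul_le_of_le_one_left (norm_nonneg _) inv_mul_le_one
  have hvan : ∀ g : restrict E (nonzeroSet Ω θ), ∀ ω ∉ nonzeroSet Ω θ, value ω (g : E) = 0 :=
    fun g ω hω => value_eq_zero_iff.2 (g.2 ω hω)
  -- The dominating section is `g` itself, which vanishes outside `Ω_θ`.
  have hJ : ∀ g : restrict E (nonzeroSet Ω θ), ∃ x : F, ∀ ω : Ω,
      value ω x = (((ψ ω)⁻¹ : ℝ) : ℂ) • value ω (θ g) := fun g =>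
    exists_section_smul (hψU.inv₀ fun ω hω => (hpos ω hω).ne') (hvan g) fun ω => by
      rw [← hlocal.fibreMap_value]
      exact hinv ω _
  choose j hj using hJ
  let J : restrict E (nonzeroSet Ω θ) →ₗ[ℂ] restrict F (nonzeroSet Ω θ) :=
    { toFun g := ⟨j g, fun ω hω => value_eq_zero_iff.1 (by
        rw [hj, hlocal.value_eq_zero_of_value_eq_zero (hvan g ω hω), smul_zero])⟩
      map_add' g g' := Subtype.ext <| ext_value Ω fun ω => by
        simp only [Submodule.coe_add, map_add, hj, smul_add]
      map_smul' c g := Subtype.ext <| ext_value Ω fun ω => by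
        simp only [Submodule.coe_smul, map_smul, hj, RingHom.id_apply]
        rw [smul_comm] }
  have hJv : ∀ g (ω : Ω), value ω (J g : F) =
      (((ψ ω)⁻¹ : ℝ) : ℂ) • hlocal.fibreMap ω (value ω (g : E)) := fun g ω => by
    rw [hlocal.fibreMap_value]
    exact hj g ω
  refine ⟨BoundedContinuousFunction.ofNormedAddCommGroup (fun ω => ψ ω) hψU.domRestrict C fun ω => ?_,
    J, fun ω => hpos ω ω.2, ⟨⟨1, fun g => ?_⟩, fun a g => ?_⟩, fun ω => ?_⟩
  · rw [Real.norm_of_nonneg (hψ0 ω)]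
    exact hC ω
  · rw [one_mul]
    change ‖(J g : F)‖ ≤ ‖(g : E)‖
    refine norm_le_of_norm_value_le Ω (norm_nonneg _) fun ω => ?_
    rw [hJv]
    exact (hinv ω _).trans (norm_value_le ω (g : E))
  · refine Subtype.ext <| ext_value Ω fun ω => ?_
    rw [hJv, coe_smul_restrict, coe_smul_restrict, value_smul, value_smul, hJv, map_smul,
      smul_comm]
  · have hω : (ψ ω : ℂ) ≠ 0 := Complex.ofReal_ne_zero.2 (hpos ω ω.2).ne'
    refine ⟨⟨(((ψ ω)⁻¹ : ℝ) : ℂ) • hlocal.fibreMap ω, fun ξ => ?_⟩, fun g => (hJv g ω).symm,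
      fun e => ?_⟩
    · rw [LinearMap.smul_apply, norm_smul, hnormT, Complex.norm_real,
        Real.norm_of_nonneg (inv_nonneg.2 (hψ0 ω)), ← mul_assoc,
        inv_mul_cancel₀ (hpos ω ω.2).ne', one_mul]
    · change _ = (ψ ω : ℂ) • (((ψ ω)⁻¹ : ℝ) : ℂ) • hlocal.fibreMap ω (value (ω : Ω) e)
      rw [smul_smul, Complex.ofReal_inv, mul_inv_cancel₀ hω, one_smul, hlocal.fibreMap_value]
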